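/- For a group $G$ let $\omega(G)$ denote the number (cardinality of the set) of orbits of the natural action of the automorphism group $\mathrm{Aut}(G)$ on $G$. Let $F$ be a field (possibly infinite) of characteristic $2$ with more than $2$ elements, and let $m \ge 2$ be an integer. Let $\mathrm{M}(2\times m,F)$ be the additive group of $2\times m$ matrices with entries in $F$, and let $\mathrm{SL}(2,F)$, the group of $2\times 2$ matrices over $F$ of determinant $1$, act on it by multiplication from the left. Then $$\omega\bigl(\mathrm{SL}(2,F)\ltimes \mathrm{M}(2\times m,F)\bigr)=3+\omega\bigl(\mathrm{SL}(2,F)\bigr),$$ as an equality of cardinal numbers. -/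

import Mathlib

universe u

/-- The number of automorphism orbits of a group `G`, as a cardinal: the cardinality of the set of
orbits of the natural action of `Aut(G)` on `G`. -/
noncomputable def autOrbitCount (G : Type u) [Group G] : Cardinal.{u} :=
  Cardinal.mk (MulAction.orbitRel.Quotient (MulAut G) G)

/-- Left multiplication by `X ∈ SL(2,F)`, as an automorphism of the additive group of
`2 × m` matrices, the latter being written multiplicatively. -/
def leftMulAut (F : Type u) [Field F] (m : ℕ) (X : Matrix.SpecialLinearGroup (Fin 2) F) :
    MulAut (Multiplicative (Matrix (Fin 2) (Fin m) F)) where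
  toFun Y := Multiplicative.ofAdd ((X : Matrix (Fin 2) (Fin 2) F) * Y.toAdd)
  invFun Y := Multiplicative.ofAdd
    (((X⁻¹ : Matrix.SpecialLinearGroup (Fin 2) F) : Matrix (Fin 2) (Fin 2) F) * Y.toAdd)
  left_inv Y := by
    change Multiplicative.ofAdd (((X⁻¹ : Matrix.SpecialLinearGroup (Fin 2) F) : Matrix (Fin 2) (Fin 2) F) *
      ((X : Matrix (Fin 2) (Fin 2) F) * Y.toAdd)) = Y
    rw [← Matrix.mul_assoc, ← Matrix.SpecialLinearGroup.coe_mul, inv_mul_cancel,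
      Matrix.SpecialLinearGroup.coe_one, Matrix.one_mul, ofAdd_toAdd]
  right_inv Y := by
    change Multiplicative.ofAdd ((X : Matrix (Fin 2) (Fin 2) F) *
      (((X⁻¹ : Matrix.SpecialLinearGroup (Fin 2) F) : Matrix (Fin 2) (Fin 2) F) * Y.toAdd)) = Y
    rw [← Matrix.mul_assoc, ← Matrix.SpecialLinearGroup.coe_mul, mul_inv_cancel,
      Matrix.SpecialLinearGroup.coe_one, Matrix.one_mul, ofAdd_toAdd]
  map_mul' Y Z := by
    simp only [toAdd_mul, Matrix.mul_add, ofAdd_add]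

/-- The action of `SL(2,F)` on the `2 × m` matrices over `F` by left multiplication. -/
def leftMulAction (F : Type u) [Field F] (m : ℕ) :
    Matrix.SpecialLinearGroup (Fin 2) F →*
      MulAut (Multiplicative (Matrix (Fin 2) (Fin m) F)) where
  toFun X := leftMulAut F m X
  map_one' := by
    ext1 Y
    change Multiplicative.ofAdd
      (((1 : Matrix.SpecialLinearGroup (Fin 2) F) : Matrix (Fin 2) (Fin 2) F) * Y.toAdd) = Y
    rw [Matrix.SpecialLinearGroup.coe_one, Matrix.one_mul, ofAdd_toAdd]
  map_mul' X X' := by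
    ext1 Y
    change Multiplicative.ofAdd
      (((X * X' : Matrix.SpecialLinearGroup (Fin 2) F) : Matrix (Fin 2) (Fin 2) F) * Y.toAdd)
      = Multiplicative.ofAdd
        ((X : Matrix (Fin 2) (Fin 2) F) * ((X' : Matrix (Fin 2) (Fin 2) F) * Y.toAdd))
    rw [Matrix.SpecialLinearGroup.coe_mul, Matrix.mul_assoc]

/-- The group `G_{m,F} = SL(2,F) ⋉ M(2 × m, F)`. -/
abbrev AffineSL (m : ℕ) (F : Type u) [Field F] : Type u :=
  Multiplicative (Matrix (Fin 2) (Fin m) F) ⋊[leftMulAction F m]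
    Matrix.SpecialLinearGroup (Fin 2) F

/-!
Write `S = SL(2, F)`, `V = M(2 × m, F)` and `G = S ⋉ V`. The orbits of `Aut(G)` on `G` are shown to
be in bijection with `Fin 3` together with the orbits of `Aut(S)` on `S`: the orbit of `s` goes to
the orbit of `(0, s)`, and the three further orbits are represented by a matrix of rank one, a
matrix of rank two, and an element of order four.

The map `s ↦ (0, s)` is well defined on orbits because every automorphism of `S` lifts to `G`
(`autLifts`). In characteristic two the involutions of `S` are the nontrivial unipotent elements,
and their centralizers are the root subgroups. Hence, up to conjugation in `GL(2, F)`, an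
automorphism of `S` preserves the upper and the lower root subgroup. It then acts on both of them by
the same map of `F`, which turns out to be a field automorphism (`exists_ringAut_of_fix`), so that
the automorphism of `S` is semilinear and acts compatibly on `V`.

Orbits stay apart because `V` is characteristic (`right_apply_affElt_one`): its image in `S` under an
automorphism followed by the projection is normal, abelian and of exponent two, hence trivial.
Therefore automorphisms of `G` induce automorphisms of `S`. Rank one and rank two are distinguished
by whether some `s ≠ 1` fixes the matrix, and the element of order four lies over an involution of
`S`, while the elements `(0, s)` over an involution are themselves involutions.

Every orbit is reached (`exists_autConj_rep`): if `s` does not have eigenvalue `1`, then `(Y, s)` is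
conjugate to `(0, s)` under `V`; if `s` is an involution, one may take it to be
`!![1, 1; 0, 1]`, use `V` to clear the first row of `Y`, and use a linear automorphism acting on
rows to normalize the second one. For `s = 1`, the rows of `Y` are normalized by `S` and by such
linear automorphisms.
-/

open Matrix
open scoped MatrixGroups

/-! ### Unipotent matrices and automorphisms of `SL(2, F)` -/

section Unipotent

variable {F : Type u} [Field F]

/-- The upper unipotent matrix with off-diagonal entry `x`. -/
def upperUnip (x : F) : SL(2, F) := ⟨!![1, x; 0, 1], by simp⟩

/-- The lower unipotent matrix with off-diagonal entry `x`. -/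
def lowerUnip (x : F) : SL(2, F) := ⟨!![1, 0; x, 1], by simp⟩

theorem sl_ext_iff {s t : SL(2, F)} : s = t ↔
    s.1 0 0 = t.1 0 0 ∧ s.1 0 1 = t.1 0 1 ∧ s.1 1 0 = t.1 1 0 ∧ s.1 1 1 = t.1 1 1 := by
  refine ⟨by rintro rfl; simp, fun ⟨h1, h2, h3, h4⟩ => Subtype.ext ?_⟩
  ext i j
  fin_cases i <;> fin_cases j <;> assumption

theorem sl_det (s : SL(2, F)) : s.1 0 0 * s.1 1 1 - s.1 0 1 * s.1 1 0 = 1 := by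
  rw [← det_fin_two, s.2]

theorem sl_mul_apply (s t : SL(2, F)) (i j : Fin 2) :
    (s * t).1 i j = s.1 i 0 * t.1 0 j + s.1 i 1 * t.1 1 j := by
  change (s.1 * t.1) i j = _
  simp [Matrix.mul_apply]

@[simp] theorem upperUnip_val (x : F) : (upperUnip x).1 = !![1, x; 0, 1] := rfl
@[simp] theorem lowerUnip_val (x : F) : (lowerUnip x).1 = !![1, 0; x, 1] := rfl

theorem upperUnip_mul (x y : F) : upperUnip x * upperUnip y = upperUnip (x + y) := by
  simp [sl_ext_iff, sl_mul_apply, add_comm]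

theorem lowerUnip_mul (x y : F) : lowerUnip x * lowerUnip y = lowerUnip (x + y) := by
  simp [sl_ext_iff, sl_mul_apply]

/-- The automorphism of `SL(2, F)` applying a field automorphism to each entry. -/
def mapRingAut (σ : F ≃+* F) : MulAut SL(2, F) where
  toFun := SpecialLinearGroup.map σ.toRingHom
  invFun := SpecialLinearGroup.map σ.symm.toRingHom
  left_inv s := by ext; simp
  right_inv s := by ext; simp
  map_mul' s t := map_mul _ s t

theorem mapRingAut_apply (σ : F ≃+* F) (s : SL(2, F)) (i j : Fin 2) :
    (mapRingAut σ s).1 i j = σ (s.1 i j) := rfl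

/-- Conjugation by an element of `GL(2, F)`, as an automorphism of `SL(2, F)`. -/
def glConj (P : GL (Fin 2) F) : MulAut SL(2, F) where
  toFun s := ⟨P.1 * s.1 * P⁻¹.1, by
    rw [det_mul, det_mul, s.2, mul_one, ← det_mul, ← Units.val_mul, mul_inv_cancel,
      Units.val_one, det_one]⟩
  invFun s := ⟨P⁻¹.1 * s.1 * P.1, by
    rw [det_mul, det_mul, s.2, mul_one, ← det_mul, ← Units.val_mul, inv_mul_cancel,
      Units.val_one, det_one]⟩
  left_inv s := Subtype.ext <| by simp [mul_assoc]
  right_inv s := Subtype.ext <| by simp [mul_assoc]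
  map_mul' s t := Subtype.ext <| by
    change _ = (P.1 * s.1 * P⁻¹.1) * (P.1 * t.1 * P⁻¹.1)
    simp [mul_assoc]

theorem glConj_apply_mul (P : GL (Fin 2) F) (s : SL(2, F)) :
    (glConj P s).1 * P.1 = P.1 * s.1 := by
  change P.1 * s.1 * P⁻¹.1 * P.1 = _
  simp [mul_assoc]

theorem upperUnip_ne_one {x : F} (hx : x ≠ 0) : upperUnip x ≠ 1 := by
  simpa [sl_ext_iff] using hx

variable [CharP F 2]

theorem upperUnip_mul_self (x : F) : upperUnip x * upperUnip x = 1 := by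
  simp [sl_ext_iff, sl_mul_apply, CharTwo.add_self_eq_zero]

theorem lowerUnip_mul_self (x : F) : lowerUnip x * lowerUnip x = 1 := by
  simp [sl_ext_iff, sl_mul_apply, CharTwo.add_self_eq_zero]

/-- By Cayley–Hamilton `s * s = tr(s) s + 1` in characteristic two, so `s * s = 1` means that the
trace vanishes, i.e. that the diagonal entries agree. -/
theorem trace_eq_zero_of_mul_self {s : SL(2, F)} (h : s * s = 1) : s.1 0 0 = s.1 1 1 := by
  have h2 : (2 : F) = 0 := CharTwo.two_eq_zero
  have hd := sl_det s
  simp only [sl_ext_iff, sl_mul_apply] at h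
  simp at h
  grind

theorem mul_self_of_trace_eq_zero {s : SL(2, F)} (h : s.1 0 0 = s.1 1 1) : s * s = 1 := by
  have h2 : (2 : F) = 0 := CharTwo.two_eq_zero
  have hd := sl_det s
  simp only [sl_ext_iff, sl_mul_apply]
  simp
  grind

/-- The centralizer of a nontrivial upper unipotent matrix is the upper root subgroup. This uses
characteristic two, where `1` is the only square root of `1`. -/
theorem commute_upperUnip {x : F} (hx : x ≠ 0) {s : SL(2, F)}
    (h : s * upperUnip x = upperUnip x * s) : ∃ y, s = upperUnip y := by
  have h2 : (2 : F) = 0 := CharTwo.two_eq_zero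
  have hd := sl_det s
  simp only [sl_ext_iff, sl_mul_apply] at h
  simp at h
  refine ⟨s.1 0 1, ?_⟩
  simp only [sl_ext_iff]
  simp
  have : s.1 1 0 = 0 := by grind
  have h3 : s.1 0 0 = s.1 1 1 := by grind
  have : (s.1 0 0 - 1) ^ 2 = 0 := by grind
  have := pow_eq_zero_iff (two_ne_zero) |>.1 this
  grind

theorem commute_lowerUnip {x : F} (hx : x ≠ 0) {s : SL(2, F)}
    (h : s * lowerUnip x = lowerUnip x * s) : ∃ y, s = lowerUnip y := by
  have h2 : (2 : F) = 0 := CharTwo.two_eq_zero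
  have hd := sl_det s
  simp only [sl_ext_iff, sl_mul_apply] at h
  simp at h
  refine ⟨s.1 1 0, ?_⟩
  simp only [sl_ext_iff]
  simp
  have : s.1 0 1 = 0 := by grind
  have h3 : s.1 0 0 = s.1 1 1 := by grind
  have : (s.1 0 0 - 1) ^ 2 = 0 := by grind
  have := pow_eq_zero_iff (two_ne_zero) |>.1 this
  grind

/-- A nontrivial involution fails to commute with its conjugate by `upperUnip 1` or by
`lowerUnip 1`, so no nontrivial elementary abelian `2`-subgroup of `SL(2, F)` is normal. -/
theorem eq_one_of_mul_self_of_commute_conj {s : SL(2, F)} (hs : s * s = 1)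
    (h : ∀ g : SL(2, F), (g * s * g⁻¹) * s = s * (g * s * g⁻¹)) : s = 1 := by
  have h2 : (2 : F) = 0 := CharTwo.two_eq_zero
  have ht := trace_eq_zero_of_mul_self hs
  have hd := sl_det s
  have hu := h (upperUnip 1)
  have hl := h (lowerUnip 1)
  rw [inv_eq_of_mul_eq_one_left (upperUnip_mul_self (1 : F))] at hu
  rw [inv_eq_of_mul_eq_one_left (lowerUnip_mul_self (1 : F))] at hl
  simp only [sl_ext_iff, sl_mul_apply] at hu hl ⊢
  simp at hu hl ⊢
  have hc : (s.1 1 0) ^ 2 = 0 := by grind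
  have hb : (s.1 0 1) ^ 2 = 0 := by grind
  have hc := pow_eq_zero_iff (two_ne_zero) |>.1 hc
  have hb := pow_eq_zero_iff (two_ne_zero) |>.1 hb
  have : (s.1 0 0 - 1) ^ 2 = 0 := by grind
  have := pow_eq_zero_iff (two_ne_zero) |>.1 this
  grind

/-- The columns of `P` are a fixed vector of `s` and a vector that `s` moves by this fixed vector. -/
theorem exists_gl_mul_eq_mul_upperUnip {s : SL(2, F)} (hs : s * s = 1) (h1 : s ≠ 1) :
    ∃ P : GL (Fin 2) F, s.1 * P.1 = P.1 * (upperUnip 1).1 := by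
  have h2 : (2 : F) = 0 := CharTwo.two_eq_zero
  have ht := trace_eq_zero_of_mul_self hs
  have hd := sl_det s
  by_cases hc : s.1 1 0 = 0
  · have ha : (s.1 0 0 - 1) ^ 2 = 0 := by grind
    have ha := pow_eq_zero_iff (two_ne_zero) |>.1 ha
    have hb : s.1 0 1 ≠ 0 := by
      intro hb
      apply h1
      rw [sl_ext_iff]
      simp
      grind
    refine ⟨GeneralLinearGroup.mkOfDetNeZero !![s.1 0 1, 0; 0, 1] (by simpa), ?_⟩
    change s.1 * !![s.1 0 1, 0; 0, 1] = !![s.1 0 1, 0; 0, 1] * _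
    ext i j
    fin_cases i <;> fin_cases j <;> simp [Matrix.mul_apply] <;> grind
  · refine ⟨GeneralLinearGroup.mkOfDetNeZero !![s.1 0 0 + 1, 1; s.1 1 0, 0] (by simpa), ?_⟩
    change s.1 * !![s.1 0 0 + 1, 1; s.1 1 0, 0] = !![s.1 0 0 + 1, 1; s.1 1 0, 0] * _
    ext i j
    fin_cases i <;> fin_cases j <;> simp [Matrix.mul_apply] <;> grind

theorem exists_glConj_eq_upperUnip {s : SL(2, F)} (hs : s * s = 1) (h1 : s ≠ 1) :
    ∃ P : GL (Fin 2) F, glConj P s = upperUnip 1 := by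
  obtain ⟨P, hP⟩ := exists_gl_mul_eq_mul_upperUnip hs h1
  refine ⟨P⁻¹, Subtype.ext ?_⟩
  change P⁻¹.1 * s.1 * P⁻¹⁻¹.1 = _
  rw [inv_inv, Matrix.mul_assoc, hP, ← Matrix.mul_assoc]
  simp

/-- An involution not commuting with `upperUnip 1` fixes a line other than the first axis; an upper
unipotent matrix moves this line to the second axis. -/
theorem exists_conj_eq_lowerUnip {t : SL(2, F)} (ht : t * t = 1)
    (hc : t * upperUnip 1 ≠ upperUnip 1 * t) :
    ∃ x y : F, y ≠ 0 ∧ upperUnip x * t = lowerUnip y * upperUnip x := by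
  have h2 : (2 : F) = 0 := CharTwo.two_eq_zero
  have h := trace_eq_zero_of_mul_self ht
  have hd := sl_det t
  have hc : t.1 1 0 ≠ 0 := by
    intro h0
    apply hc
    simp only [sl_ext_iff, sl_mul_apply]
    simp
    grind
  refine ⟨(t.1 0 0 + 1) / t.1 1 0, t.1 1 0, hc, ?_⟩
  simp only [sl_ext_iff, sl_mul_apply]
  simp
  grind

/-- `SL(2, F)` is generated by the upper and the lower unipotent matrices. -/
theorem induction_unipotent {p : SL(2, F) → Prop} (hu : ∀ x, p (upperUnip x))
    (hl : ∀ x, p (lowerUnip x)) (hmul : ∀ s t, p s → p t → p (s * t)) (s : SL(2, F)) : p s := by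
  have h2 : (2 : F) = 0 := CharTwo.two_eq_zero
  have key : ∀ s : SL(2, F), s.1 1 0 ≠ 0 → p s := by
    intro s hs
    have : s = upperUnip ((s.1 0 0 + 1) / s.1 1 0) * lowerUnip (s.1 1 0) *
        upperUnip ((s.1 1 1 + 1) / s.1 1 0) := by
      have hd := sl_det s
      simp only [sl_ext_iff, sl_mul_apply]
      simp
      grind
    rw [this]
    exact hmul _ _ (hmul _ _ (hu _) (hl _)) (hu _)
  by_cases hs : s.1 1 0 = 0
  · have : s = lowerUnip 1 * (lowerUnip 1 * s) := by
      rw [← mul_assoc, lowerUnip_mul_self, one_mul]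
    rw [this]
    refine hmul _ _ (hl _) (key _ ?_)
    have hd := sl_det s
    simp [sl_mul_apply]
    grind
  · exact key s hs

/-- The diagonal matrix with entries `x` and `x⁻¹` (for `x ≠ 0`), written as a word in unipotent
matrices, so that its image under an automorphism that permutes these matrices can be read off. -/
def torusWord (x : F) : SL(2, F) :=
  (upperUnip x * lowerUnip x⁻¹ * upperUnip x) * (upperUnip 1 * lowerUnip 1⁻¹ * upperUnip 1)

theorem torusWord_val {x : F} (hx : x ≠ 0) : (torusWord x).1 = !![x, 0; 0, x⁻¹] := by
  have h2 : (2 : F) = 0 := CharTwo.two_eq_zero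
  ext i j
  fin_cases i <;> fin_cases j <;> simp [torusWord, sl_mul_apply] <;> grind

theorem torusWord_mul {x y : F} (hx : x ≠ 0) (hy : y ≠ 0) :
    torusWord (x * y) = torusWord x * torusWord y := by
  simp only [sl_ext_iff, sl_mul_apply, torusWord_val, hx, hy, mul_ne_zero hx hy, ne_eq,
    not_false_eq_true]
  simp [mul_comm]

/-- An automorphism fixing `upperUnip 1` and mapping `lowerUnip 1` to a lower unipotent matrix
preserves both root subgroups, as they are the centralizers of these elements. It acts on them
through additive maps `f` and `g`. The Weyl elements
`upperUnip x * lowerUnip x⁻¹ * upperUnip x` force `g x⁻¹ = (f x)⁻¹`, and the torus they generate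
forces `f` to be multiplicative. -/
theorem exists_ringAut_of_fix {α : MulAut SL(2, F)} (hu : α (upperUnip 1) = upperUnip 1)
    {y₀ : F} (hy₀ : y₀ ≠ 0) (hl : α (lowerUnip 1) = lowerUnip y₀) :
    ∃ σ : F ≃+* F, α = mapRingAut σ := by
  have h2 : (2 : F) = 0 := CharTwo.two_eq_zero
  have hU : ∀ x, ∃ y, α (upperUnip x) = upperUnip y := fun x =>
    commute_upperUnip one_ne_zero (by
      rw [← hu, ← map_mul, ← map_mul, upperUnip_mul, upperUnip_mul, add_comm])
  have hL : ∀ x, ∃ y, α (lowerUnip x) = lowerUnip y := fun x =>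
    commute_lowerUnip hy₀ (by
      rw [← hl, ← map_mul, ← map_mul, lowerUnip_mul, lowerUnip_mul, add_comm])
  have hU' : ∀ x, ∃ y, α (upperUnip y) = upperUnip x := fun x => by
    obtain ⟨y, hy⟩ := commute_upperUnip (s := α.symm (upperUnip x)) one_ne_zero (by
      apply α.injective
      rw [map_mul, map_mul, MulEquiv.apply_symm_apply, hu, upperUnip_mul, upperUnip_mul, add_comm])
    exact ⟨y, by rw [← hy, MulEquiv.apply_symm_apply]⟩
  choose f hf using hU
  choose g hg using hL
  have uinj : ∀ {x y : F}, upperUnip x = upperUnip y → x = y := fun h => by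
    simpa [sl_ext_iff] using h
  have linj : ∀ {x y : F}, lowerUnip x = lowerUnip y → x = y := fun h => by
    simpa [sl_ext_iff] using h
  have f_one : f 1 = 1 := uinj (by rw [← hf, hu])
  have f_add : ∀ x y, f (x + y) = f x + f y := fun x y => uinj (by
    rw [← hf, ← upperUnip_mul, map_mul, hf, hf, upperUnip_mul])
  have f_inj : Function.Injective f := fun x y h => uinj (α.injective (by rw [hf, hf, h]))
  have f_zero : f 0 = 0 := by simpa using f_add 0 0
  have f_ne : ∀ x, x ≠ 0 → f x ≠ 0 := fun x hx h => hx (f_inj (h.trans f_zero.symm))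
  have fg : ∀ x, x ≠ 0 → g x⁻¹ = (f x)⁻¹ := by
    intro x hx
    -- The Weyl element conjugates the lower to the upper root subgroup; since `α` preserves both,
    -- the lower left entry of the image of this relation reads `(1 + f x * g x⁻¹) * y₀ = 0`.
    have e : upperUnip x * lowerUnip x⁻¹ * upperUnip x * lowerUnip 1 =
        upperUnip (x ^ 2) * (upperUnip x * lowerUnip x⁻¹ * upperUnip x) := by
      simp only [sl_ext_iff, sl_mul_apply]
      simp
      grind
    have e' := congrArg α e
    simp only [map_mul, hf, hg] at e'
    simp only [sl_ext_iff, sl_mul_apply] at e'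
    simp at e'
    have hX := f_ne x hx
    have := linj ((hg 1).symm.trans hl)
    grind
  have torus : ∀ x : F, x ≠ 0 → α (torusWord x) = torusWord (f x) := by
    intro x hx
    simp only [torusWord, map_mul, hf, hg]
    rw [fg _ hx, fg _ one_ne_zero, f_one]
  have f_mul : ∀ x y, f (x * y) = f x * f y := by
    intro x y
    by_cases hx : x = 0
    · simp [hx, f_zero]
    by_cases hy : y = 0
    · simp [hy, f_zero]
    have e := congrArg α (torusWord_mul hx hy)
    rw [map_mul, torus _ hx, torus _ hy, torus _ (mul_ne_zero hx hy),
      ← torusWord_mul (f_ne _ hx) (f_ne _ hy)] at e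
    have e' := congrArg (fun s => s.1 0 0) e
    simpa [torusWord_val, f_ne, hx, hy] using e'
  -- `g 0 = 0` because `lowerUnip 0 = upperUnip 0`.
  have hgf : ∀ x, g x = f x := by
    intro x
    by_cases hx : x = 0
    · subst hx
      have : lowerUnip (0 : F) = upperUnip 0 := by simp [sl_ext_iff]
      have h0 := hg 0
      rw [this, hf, f_zero, ← this] at h0
      rw [f_zero, ← linj h0]
    · have h1 := fg x⁻¹ (inv_ne_zero hx)
      rw [inv_inv] at h1
      rw [h1]
      refine inv_eq_of_mul_eq_one_left ?_
      rw [← f_mul, mul_inv_cancel₀ hx, f_one]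
  let f' : F →+* F :=
    { toFun := f, map_one' := f_one, map_mul' := f_mul, map_zero' := f_zero, map_add' := f_add }
  have f_surj : Function.Surjective f := fun x => by
    obtain ⟨y, hy⟩ := hU' x
    exact ⟨y, uinj (by rw [← hf, hy])⟩
  refine ⟨RingEquiv.ofBijective f' ⟨f_inj, f_surj⟩, MulEquiv.ext fun s => ?_⟩
  induction s using induction_unipotent with
  | hu x => rw [hf, sl_ext_iff]; simp [mapRingAut_apply]; rfl
  | hl x => rw [hg, hgf, sl_ext_iff]; simp [mapRingAut_apply]; rfl
  | hmul s t hs ht => rw [map_mul, map_mul, hs, ht]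

end Unipotent

/-! ### Lifting automorphisms of `SL(2, F)` to the semidirect product -/

section Lift

variable {F : Type u} [Field F] {m : ℕ}

/-- The automorphism `α` of `SL(2, F)` is accompanied by an additive automorphism of the
`2 × m` matrices that is semilinear with respect to `α`. Such a pair is an automorphism of the
semidirect product. -/
def AutLifts (m : ℕ) (α : MulAut SL(2, F)) : Prop :=
  ∃ n : Matrix (Fin 2) (Fin m) F ≃+ Matrix (Fin 2) (Fin m) F,
    ∀ (s : SL(2, F)) (Y : Matrix (Fin 2) (Fin m) F), n (s.1 * Y) = (α s).1 * n Y

theorem AutLifts.mul {α β : MulAut SL(2, F)} (hα : AutLifts m α) (hβ : AutLifts m β) :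
    AutLifts m (α * β) := by
  obtain ⟨a, ha⟩ := hα
  obtain ⟨b, hb⟩ := hβ
  exact ⟨b.trans a, fun s Y => by simp [ha, hb]⟩

theorem AutLifts.inv {α : MulAut SL(2, F)} (hα : AutLifts m α) : AutLifts m α⁻¹ := by
  obtain ⟨a, ha⟩ := hα
  refine ⟨a.symm, fun s Y => a.injective ?_⟩
  rw [ha, a.apply_symm_apply, a.apply_symm_apply, MulAut.apply_inv_self]

theorem autLifts_glConj (P : GL (Fin 2) F) : AutLifts m (glConj P) :=
  ⟨{ toFun := fun Y => P.1 * Y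
     invFun := fun Y => P⁻¹.1 * Y
     left_inv := fun Y => by simp [← Matrix.mul_assoc]
     right_inv := fun Y => by simp [← Matrix.mul_assoc]
     map_add' := Matrix.mul_add _ }, fun s Y => by
    change P.1 * (s.1 * Y) = (glConj P s).1 * (P.1 * Y)
    rw [← Matrix.mul_assoc, ← Matrix.mul_assoc, glConj_apply_mul]⟩

theorem autLifts_mapRingAut (σ : F ≃+* F) : AutLifts m (mapRingAut σ) :=
  ⟨σ.toAddEquiv.mapMatrix, fun s Y => by
    ext i j
    simp [Matrix.mul_apply, mapRingAut_apply]⟩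

theorem AutLifts.of_mul_left {α β : MulAut SL(2, F)} (hα : AutLifts m α)
    (h : AutLifts m (α * β)) : AutLifts m β := by
  simpa using hα.inv.mul h

/-- Every automorphism of `SL(2, F)` lifts: after composition with two conjugations by elements of
`GL(2, F)` it fixes `upperUnip 1` and maps `lowerUnip 1` to a lower unipotent matrix. -/
theorem autLifts [CharP F 2] (α : MulAut SL(2, F)) : AutLifts m α := by
  obtain ⟨P, hP⟩ := exists_glConj_eq_upperUnip (s := α (upperUnip 1))
    (by rw [← map_mul, upperUnip_mul_self, map_one])
    (by rw [ne_eq, map_eq_one_iff α α.injective]; exact upperUnip_ne_one one_ne_zero)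
  refine AutLifts.of_mul_left (autLifts_glConj P) ?_
  replace hP : (glConj P * α) (upperUnip 1) = upperUnip 1 := hP
  generalize glConj P * α = β at hP
  obtain ⟨x, y, hy, hxy⟩ := exists_conj_eq_lowerUnip (t := β (lowerUnip 1))
    (by rw [← map_mul, lowerUnip_mul_self, map_one])
    (by
      intro h
      rw [← hP, ← map_mul, ← map_mul] at h
      simpa [sl_ext_iff, sl_mul_apply] using β.injective h)
  refine AutLifts.of_mul_left (autLifts_glConj (upperUnip x : GL (Fin 2) F)) ?_
  have key : ∀ s t : SL(2, F), upperUnip x * s = t * upperUnip x →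
      glConj (upperUnip x : GL (Fin 2) F) s = t := by
    intro s t h
    rw [← mul_inv_eq_iff_eq_mul] at h
    exact h
  obtain ⟨σ, hσ⟩ := exists_ringAut_of_fix
    (α := glConj (upperUnip x : GL (Fin 2) F) * β)
    (key _ _ (by
      change _ * β (upperUnip 1) = _
      rw [hP, upperUnip_mul, upperUnip_mul, add_comm])) hy (key _ _ hxy)
  rw [hσ]
  exact autLifts_mapRingAut σ

end Lift

/-! ### Automorphisms of the semidirect product -/

section Orbits

variable {F : Type u} [Field F] {m : ℕ}

/-- The element `(Y, s)` of the semidirect product. -/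
def affElt (Y : Matrix (Fin 2) (Fin m) F) (s : SL(2, F)) : AffineSL m F :=
  ⟨Multiplicative.ofAdd Y, s⟩

theorem affElt_mul (Y Z : Matrix (Fin 2) (Fin m) F) (s t : SL(2, F)) :
    affElt Y s * affElt Z t = affElt (Y + s.1 * Z) (s * t) := rfl

theorem affElt_zero_one : affElt (0 : Matrix (Fin 2) (Fin m) F) 1 = 1 := rfl

theorem affElt_inj {Y Z : Matrix (Fin 2) (Fin m) F} {s t : SL(2, F)} :
    affElt Y s = affElt Z t ↔ Y = Z ∧ s = t := by
  refine ⟨fun h => ⟨?_, ?_⟩, by rintro ⟨rfl, rfl⟩; rfl⟩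
  · exact congrArg (fun g : AffineSL m F => g.left.toAdd) h
  · exact congrArg SemidirectProduct.right h

theorem affElt_eta (g : AffineSL m F) : affElt g.left.toAdd g.right = g := rfl

/-- Two elements of a group lie in the same orbit of its automorphism group. -/
def AutConj {G : Type*} [Group G] (g h : G) : Prop := ∃ φ : MulAut G, φ g = h

theorem AutConj.trans {G : Type*} [Group G] {g h k : G} : AutConj g h → AutConj h k → AutConj g k
  | ⟨φ, hφ⟩, ⟨ψ, hψ⟩ => ⟨ψ * φ, by rw [MulAut.mul_apply, hφ, hψ]⟩

theorem AutConj.symm {G : Type*} [Group G] {g h : G} : AutConj g h → AutConj h g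
  | ⟨φ, hφ⟩ => ⟨φ⁻¹, by rw [← hφ, MulAut.inv_apply_self]⟩

/-- The automorphism of the semidirect product given by an automorphism `α` of `SL(2, F)` and an
`α`-semilinear automorphism `n` of the `2 × m` matrices. -/
def liftAut (n : Matrix (Fin 2) (Fin m) F ≃+ Matrix (Fin 2) (Fin m) F) (α : MulAut SL(2, F))
    (h : ∀ (s : SL(2, F)) Y, n (s.1 * Y) = (α s).1 * n Y) : MulAut (AffineSL m F) :=
  SemidirectProduct.congr n.toMultiplicative α fun s => MulEquiv.ext fun Y => h s Y.toAdd

theorem liftAut_apply (n : Matrix (Fin 2) (Fin m) F ≃+ Matrix (Fin 2) (Fin m) F)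
    (α : MulAut SL(2, F)) (h : ∀ (s : SL(2, F)) Y, n (s.1 * Y) = (α s).1 * n Y)
    (Y : Matrix (Fin 2) (Fin m) F) (s : SL(2, F)) :
    liftAut n α h (affElt Y s) = affElt (n Y) (α s) := rfl

theorem AutLifts.exists_autConj {α : MulAut SL(2, F)} (hα : AutLifts m α)
    (Y : Matrix (Fin 2) (Fin m) F) (s : SL(2, F)) :
    ∃ Z, AutConj (affElt Y s) (affElt Z (α s)) :=
  let ⟨n, hn⟩ := hα
  ⟨n Y, liftAut n α hn, rfl⟩

theorem AutLifts.autConj_zero {α : MulAut SL(2, F)} (hα : AutLifts m α) (s : SL(2, F)) :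
    AutConj (affElt (0 : Matrix (Fin 2) (Fin m) F) s) (affElt 0 (α s)) :=
  let ⟨n, hn⟩ := hα
  ⟨liftAut n α hn, by rw [liftAut_apply, map_zero]⟩

/-- Conjugation by the translation `W`. -/
theorem autConj_translate (Y W : Matrix (Fin 2) (Fin m) F) (s : SL(2, F)) :
    AutConj (affElt Y s) (affElt (Y + (W - s.1 * W)) s) := by
  refine ⟨MulAut.conj (affElt W 1), ?_⟩
  rw [MulAut.conj_apply, mul_inv_eq_iff_eq_mul, affElt_mul, affElt_mul, affElt_inj]
  simp
  abel

theorem autConj_smul (Y : Matrix (Fin 2) (Fin m) F) (g : SL(2, F)) :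
    AutConj (affElt Y 1) (affElt (g.1 * Y) 1) := by
  refine ⟨MulAut.conj (affElt 0 g), ?_⟩
  rw [MulAut.conj_apply, mul_inv_eq_iff_eq_mul, affElt_mul, affElt_mul, affElt_inj]
  simp

/-- A linear automorphism of `F ^ m` acts on the rows of a matrix and commutes with the left
multiplication by `SL(2, F)`. -/
theorem autConj_rows (e : (Fin m → F) ≃ₗ[F] (Fin m → F)) (Y : Matrix (Fin 2) (Fin m) F)
    (s : SL(2, F)) : AutConj (affElt Y s) (affElt (Matrix.of fun i => e (Y i)) s) :=
  ⟨liftAut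
    { toFun := fun Y => Matrix.of fun i => e (Y i)
      invFun := fun Y => Matrix.of fun i => e.symm (Y i)
      left_inv := fun Y => funext fun i => e.symm_apply_apply (Y i)
      right_inv := fun Y => funext fun i => e.apply_symm_apply (Y i)
      map_add' := fun Y Z => by
        ext i j
        change e (Y i + Z i) j = _
        simp } 1 fun s Y => by
      ext i j
      have : (s.1 * Y) i = s.1 i 0 • Y 0 + s.1 i 1 • Y 1 := by
        ext; simp [Matrix.mul_apply]
      change e ((s.1 * Y) i) j = (s.1 * Matrix.of fun i => e (Y i)) i j
      simp [this, Matrix.mul_apply], rfl⟩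

theorem exists_linearEquiv_apply_eq {ι V : Type*} [Finite ι] [AddCommGroup V] [Module F V]
    {v w : ι → V} (hv : LinearIndependent F v) (hw : LinearIndependent F w) :
    ∃ e : V ≃ₗ[F] V, ∀ i, e (v i) = w i := by
  have : FiniteDimensional F (Submodule.span F (Set.range v)) :=
    FiniteDimensional.span_of_finite F (Set.finite_range v)
  obtain ⟨e, he⟩ := Submodule.exists_linearEquiv_restrict_eq
    (hv.linearCombinationEquiv.symm ≪≫ₗ hw.linearCombinationEquiv)
  refine ⟨e, fun i => ?_⟩
  have hi := he (hv.linearCombinationEquiv (Finsupp.single i 1))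
  simpa using hi.symm

theorem exists_linearEquiv_apply_eq_of_ne_zero {V : Type*} [AddCommGroup V] [Module F V]
    {v w : V} (hv : v ≠ 0) (hw : w ≠ 0) : ∃ e : V ≃ₗ[F] V, e v = w := by
  obtain ⟨e, he⟩ := exists_linearEquiv_apply_eq (F := F) (v := fun _ : Unit => v)
    (w := fun _ : Unit => w) (by simpa using hv) (by simpa using hw)
  exact ⟨e, he ()⟩

theorem autConj_of_linearIndependent {Y Z : Matrix (Fin 2) (Fin m) F}
    (hY : LinearIndependent F ![Y 0, Y 1]) (hZ : LinearIndependent F ![Z 0, Z 1]) (s : SL(2, F)) :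
    AutConj (affElt Y s) (affElt Z s) := by
  obtain ⟨e, he⟩ := exists_linearEquiv_apply_eq hY hZ
  convert autConj_rows e Y s
  ext i j
  have := congrFun (he i) j
  fin_cases i <;> exact this.symm

theorem autConj_of_row_one_eq_zero {Y Z : Matrix (Fin 2) (Fin m) F} (hY : Y 0 ≠ 0) (hZ : Z 0 ≠ 0)
    (hY' : Y 1 = 0) (hZ' : Z 1 = 0) (s : SL(2, F)) : AutConj (affElt Y s) (affElt Z s) := by
  obtain ⟨e, he⟩ := exists_linearEquiv_apply_eq_of_ne_zero (F := F) hY hZ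
  convert autConj_rows e Y s
  ext i j
  fin_cases i
  · exact (congrFun he j).symm
  · simp [hY', hZ']

theorem autConj_of_row_zero_eq_zero {Y Z : Matrix (Fin 2) (Fin m) F} (hY : Y 1 ≠ 0) (hZ : Z 1 ≠ 0)
    (hY' : Y 0 = 0) (hZ' : Z 0 = 0) (s : SL(2, F)) : AutConj (affElt Y s) (affElt Z s) := by
  obtain ⟨e, he⟩ := exists_linearEquiv_apply_eq_of_ne_zero (F := F) hY hZ
  convert autConj_rows e Y s
  ext i j
  fin_cases i
  · simp [hY', hZ']
  · exact (congrFun he j).symm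

/-- The second row of `g` is given by a linear relation between the rows of `Y`. -/
theorem exists_mul_row_one_eq_zero {Y : Matrix (Fin 2) (Fin m) F}
    (hY : ¬ LinearIndependent F ![Y 0, Y 1]) : ∃ g : SL(2, F), (g.1 * Y) 1 = 0 := by
  rw [LinearIndependent.pair_iff] at hY
  push Not at hY
  obtain ⟨a, b, h, hab⟩ := hY
  have row : ∀ g : SL(2, F), (g.1 * Y) 1 = g.1 1 0 • Y 0 + g.1 1 1 • Y 1 := fun g => by
    ext; simp [Matrix.mul_apply]
  by_cases ha : a = 0
  · exact ⟨⟨!![b⁻¹, 0; a, b], by simp [hab ha]⟩, (row _).trans h⟩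
  · exact ⟨⟨!![0, -a⁻¹; a, b], by simp [ha]⟩, (row _).trans h⟩

variable [CharP F 2]

theorem affElt_mul_self (Y : Matrix (Fin 2) (Fin m) F) :
    affElt Y (1 : SL(2, F)) * affElt Y 1 = 1 := by
  rw [affElt_mul, ← affElt_zero_one, affElt_inj]
  have h2 : (2 : F) = 0 := CharTwo.two_eq_zero
  refine ⟨?_, one_mul 1⟩
  ext i j
  simp [← two_mul, h2]

/-- The translation subgroup is characteristic. The component of `φ (Y, 1)` in `SL(2, F)` squares to
`1` and commutes with its conjugates, because `(Y, 1)` has these properties in the semidirect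
product and `φ` is surjective. -/
theorem right_apply_affElt_one (φ : MulAut (AffineSL m F)) (Y : Matrix (Fin 2) (Fin m) F) :
    (φ (affElt Y 1)).right = 1 := by
  apply eq_one_of_mul_self_of_commute_conj
  · rw [← SemidirectProduct.mul_right, ← map_mul, affElt_mul_self, map_one,
      SemidirectProduct.one_right]
  · intro g
    set k := φ⁻¹ (affElt 0 g) with hk
    obtain ⟨Z, hZ⟩ : ∃ Z : Matrix (Fin 2) (Fin m) F, k * affElt Y 1 * k⁻¹ = affElt Z 1 :=
      ⟨(k * affElt Y 1 * k⁻¹).left.toAdd, by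
        conv_lhs => rw [← affElt_eta (k * affElt Y 1 * k⁻¹)]
        rw [affElt_inj]
        exact ⟨rfl, by
          rw [SemidirectProduct.mul_right, SemidirectProduct.mul_right,
            SemidirectProduct.inv_right]
          change k.right * 1 * _ = 1
          simp⟩⟩
    have hc : affElt Z (1 : SL(2, F)) * affElt Y 1 = affElt Y 1 * affElt Z 1 := by
      rw [affElt_mul, affElt_mul, affElt_inj]
      simp [add_comm]
    rw [← hZ] at hc
    have := congrArg (fun x => (φ x).right) hc
    simp only [map_mul, map_inv, hk, MulAut.apply_inv_self, SemidirectProduct.mul_right,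
      SemidirectProduct.inv_right] at this
    exact this

/-- As translations are mapped to translations, the component of `φ g` in `SL(2, F)` depends only on
that of `g`. -/
theorem right_apply_eq (φ : MulAut (AffineSL m F)) (g : AffineSL m F) :
    (φ g).right = (φ (affElt 0 g.right)).right := by
  have : g = affElt g.left.toAdd 1 * affElt 0 g.right := by
    rw [affElt_mul]
    conv_lhs => rw [← affElt_eta g]
    simp
  conv_lhs => rw [this, map_mul, SemidirectProduct.mul_right, right_apply_affElt_one, one_mul]

theorem AutConj.right {g h : AffineSL m F} : AutConj g h → AutConj g.right h.right := by
  rintro ⟨φ, rfl⟩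
  refine ⟨{ toFun := fun s => (φ (affElt 0 s)).right
            invFun := fun s => (φ⁻¹ (affElt 0 s)).right
            left_inv := fun s => ?_
            right_inv := fun s => ?_
            map_mul' := fun s t => ?_ }, (right_apply_eq φ g).symm⟩
  · beta_reduce
    rw [← right_apply_eq, MulAut.inv_apply_self]; rfl
  · beta_reduce
    rw [← right_apply_eq, MulAut.apply_inv_self]; rfl
  · rw [← SemidirectProduct.mul_right, ← map_mul, affElt_mul]
    simp

/-- Having a nontrivial stabilizer in `SL(2, F)` is invariant under automorphisms of the semidirect
product: it means that the centralizer of the translation is larger than the translation subgroup. -/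
theorem AutConj.exists_smul_eq {Y Z : Matrix (Fin 2) (Fin m) F}
    (h : AutConj (affElt Y (1 : SL(2, F))) (affElt Z 1)) {s : SL(2, F)} (hs : s ≠ 1)
    (hY : s.1 * Y = Y) : ∃ t : SL(2, F), t ≠ 1 ∧ t.1 * Z = Z := by
  obtain ⟨φ, hφ⟩ := h
  refine ⟨(φ (affElt 0 s)).right, fun h1 => hs ?_, ?_⟩
  · have h2 := right_apply_eq φ⁻¹ (φ (affElt 0 s))
    rw [MulAut.inv_apply_self, h1, affElt_zero_one, map_one] at h2
    exact h2
  · have hc : affElt 0 s * affElt Y 1 = affElt Y 1 * affElt 0 s := by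
      rw [affElt_mul, affElt_mul, affElt_inj]
      simp [hY]
    have := congrArg φ hc
    rw [map_mul, map_mul, hφ, ← affElt_eta (φ (affElt 0 s)), affElt_mul, affElt_mul,
      affElt_inj] at this
    have h1 := this.1.trans (congrArg (Z + ·) (Matrix.one_mul _))
    rw [add_comm] at h1
    exact add_right_cancel h1

end Orbits

/-! ### Classification of the orbits -/

section Count

variable {F : Type u} [Field F] {m : ℕ}

theorem linearIndependent_single_pair {i j : Fin m} (hij : i ≠ j) :
    LinearIndependent F ![(Pi.single i 1 : Fin m → F), Pi.single j 1] := by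
  rw [LinearIndependent.pair_iff]
  intro a b h
  have hi := congrFun h i
  have hj := congrFun h j
  simpa [hij, hij.symm] using And.intro hi hj

theorem exists_autConj_row_zero_eq_zero (Y : Matrix (Fin 2) (Fin m) F) :
    AutConj (affElt Y (upperUnip 1)) (affElt (Matrix.of ![0, Y 1]) (upperUnip 1)) := by
  convert autConj_translate Y (Matrix.of ![0, Y 0]) (upperUnip 1)
  ext i j
  fin_cases i <;> simp

variable [CharP F 2]

/-- If `s * s ≠ 1` then `tr(s) ≠ 0`, and `det (s - 1) = 2 - tr(s)` shows that `s - 1` is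
invertible. -/
theorem exists_add_mul_eq {s : SL(2, F)} (hs : s * s ≠ 1) (Y : Matrix (Fin 2) (Fin m) F) :
    ∃ W : Matrix (Fin 2) (Fin m) F, Y + (W - s.1 * W) = 0 := by
  have h2 : (2 : F) = 0 := CharTwo.two_eq_zero
  have ht : s.1 0 0 ≠ s.1 1 1 := fun h => hs (mul_self_of_trace_eq_zero h)
  have hdet : IsUnit (s.1 - 1).det := by
    rw [isUnit_iff_ne_zero, det_fin_two]
    have hd := sl_det s
    simp
    grind
  refine ⟨(s.1 - 1)⁻¹ * Y, ?_⟩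
  have h : (s.1 - 1) * ((s.1 - 1)⁻¹ * Y) = Y := by
    rw [← Matrix.mul_assoc, Matrix.mul_nonsing_inv _ hdet, Matrix.one_mul]
  rw [Matrix.sub_mul, Matrix.one_mul] at h
  nth_rewrite 1 [← h]
  abel

/-- Representatives of the three orbits that do not meet the complement `SL(2, F)`: a matrix of
rank one, a matrix of rank two, and an element of order four. -/
def extraRep (F : Type u) [Field F] (i j : Fin m) : Fin 3 → AffineSL m F :=
  ![affElt (Matrix.of ![Pi.single i 1, 0]) 1,
    affElt (Matrix.of ![Pi.single i 1, Pi.single j 1]) 1,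
    affElt (Matrix.of ![0, Pi.single i 1]) (upperUnip 1)]

theorem exists_autConj_rep {i j : Fin m} (hij : i ≠ j) (g : AffineSL m F) :
    (∃ k, AutConj g (extraRep F i j k)) ∨ ∃ s, AutConj g (affElt 0 s) := by
  obtain ⟨Y, s, rfl⟩ : ∃ Y s, affElt Y s = g := ⟨_, _, affElt_eta g⟩
  have hne : (Pi.single i 1 : Fin m → F) ≠ 0 := by simp
  by_cases h1 : s = 1
  · subst h1
    by_cases hY : LinearIndependent F ![Y 0, Y 1]
    · exact Or.inl ⟨1, autConj_of_linearIndependent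
        (Z := Matrix.of ![Pi.single i 1, Pi.single j 1]) hY (linearIndependent_single_pair hij) 1⟩
    · obtain ⟨g, hg⟩ := exists_mul_row_one_eq_zero hY
      by_cases h0 : (g.1 * Y) 0 = 0
      · refine Or.inr ⟨1, ?_⟩
        have : g.1 * Y = 0 := by
          ext i j
          fin_cases i
          · exact congrFun h0 j
          · exact congrFun hg j
        rw [← this]
        exact autConj_smul Y g
      · exact Or.inl ⟨0, (autConj_smul Y g).trans (autConj_of_row_one_eq_zero h0 hne hg rfl 1)⟩
  by_cases hs : s * s = 1
  · obtain ⟨P, hP⟩ := exists_glConj_eq_upperUnip hs h1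
    obtain ⟨Z, hZ⟩ := (autLifts_glConj P).exists_autConj Y s
    rw [hP] at hZ
    replace hZ := hZ.trans (exists_autConj_row_zero_eq_zero Z)
    by_cases h0 : Z 1 = 0
    · refine Or.inr ⟨upperUnip 1, ?_⟩
      convert hZ
      ext i j
      fin_cases i <;> simp [h0]
    · exact Or.inl ⟨2, hZ.trans (autConj_of_row_zero_eq_zero
        (Y := Matrix.of ![0, Z 1]) (Z := Matrix.of ![0, Pi.single i 1])
        h0 hne rfl rfl _)⟩
  · obtain ⟨W, hW⟩ := exists_add_mul_eq hs Y
    refine Or.inr ⟨s, ?_⟩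
    rw [← hW]
    exact autConj_translate Y W s

theorem not_autConj_extraRep_affElt {i j : Fin m} (k : Fin 3) (s : SL(2, F)) :
    ¬ AutConj (extraRep F i j k) (affElt 0 s) := by
  intro h
  have hr := h.right
  obtain ⟨φ, hφ⟩ := h
  have key : ∀ Y : Matrix (Fin 2) (Fin m) F, extraRep F i j k = affElt Y 1 →
      Y 0 = Pi.single i 1 → False := by
    intro Y hk hY
    obtain ⟨ψ, hψ⟩ := hr
    rw [hk] at hψ hφ
    have hs : 1 = s := (map_one ψ).symm.trans hψ
    rw [← hs, affElt_zero_one, map_eq_one_iff φ φ.injective, ← affElt_zero_one, affElt_inj] at hφ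
    have := congrFun (hY.symm.trans (congrFun hφ.1 0)) i
    simp at this
  fin_cases k
  · exact key _ rfl rfl
  · exact key _ rfl rfl
  -- Here `s` is the image of an involution, so `(0, s)` squares to `1`, unlike the representative.
  · obtain ⟨ψ, hψ⟩ := hr
    replace hψ : ψ (upperUnip 1) = s := hψ
    have hs : affElt (0 : Matrix (Fin 2) (Fin m) F) s * affElt 0 s = 1 := by
      rw [affElt_mul, ← hψ, ← map_mul, upperUnip_mul_self, map_one, Matrix.mul_zero, add_zero,
        affElt_zero_one]
    rw [← hφ, ← map_mul, map_eq_one_iff φ φ.injective, ← affElt_zero_one] at hs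
    change affElt _ (upperUnip 1) * affElt _ (upperUnip 1) = _ at hs
    rw [affElt_mul, affElt_inj] at hs
    have := congrFun (congrFun hs.1 0) i
    simp at this

theorem extraRep_autConj {i j : Fin m} (hij : i ≠ j) {k l : Fin 3}
    (h : AutConj (extraRep F i j k) (extraRep F i j l)) : k = l := by
  wlog hkl : k ≤ l generalizing k l
  · exact (this h.symm (le_of_not_ge hkl)).symm
  have hu : upperUnip (1 : F) ≠ 1 := upperUnip_ne_one one_ne_zero
  have h2 : ∀ k : Fin 3, (extraRep F i j k).right = 1 ↔ k ≠ 2 := by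
    intro k
    fin_cases k
    · exact iff_of_true rfl (by decide)
    · exact iff_of_true rfl (by decide)
    · exact iff_of_false hu (by simp)
  -- Only the third representative lies outside the translation subgroup.
  have h3 : k = 2 ↔ l = 2 := by
    have := h.right
    obtain ⟨ψ, hψ⟩ := this
    rw [← not_iff_not, ← ne_eq, ← ne_eq, ← h2, ← h2, ← hψ, map_eq_one_iff ψ ψ.injective]
  -- `upperUnip 1` fixes the representative of rank one; nothing but `1` fixes that of rank two.
  have h01 : ¬ (k = 0 ∧ l = 1) := by
    rintro ⟨rfl, rfl⟩
    obtain ⟨t, ht, h⟩ := h.exists_smul_eq (s := upperUnip 1) hu (by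
      ext a b
      fin_cases a <;> simp [Matrix.mul_apply])
    apply ht
    have e := fun a b => congrFun (congrFun h a) b
    rw [sl_ext_iff]
    have e1 := e 0 i
    have e2 := e 0 j
    have e3 := e 1 i
    have e4 := e 1 j
    simp [Matrix.mul_apply, hij, hij.symm] at e1 e2 e3 e4
    simp [e1, e2, e3, e4]
  omega

end Count

/-! ### The bijection of orbit sets -/

section Cardinality

theorem orbit_mk_eq_iff {G : Type u} [Group G] {g h : G} :
    (Quotient.mk'' g : MulAction.orbitRel.Quotient (MulAut G) G) = Quotient.mk'' h ↔
      AutConj g h := by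
  rw [Quotient.eq'', MulAction.orbitRel_apply]
  exact ⟨fun ⟨φ, hφ⟩ => AutConj.symm ⟨φ, hφ⟩, fun h => h.symm⟩

end Cardinality

theorem theorem4p1 (F : Type u) [Field F] [CharP F 2] (hF : 2 < Cardinal.mk F)
    (m : ℕ) (hm : 2 ≤ m) :
    autOrbitCount (AffineSL m F) =
      3 + autOrbitCount (Matrix.SpecialLinearGroup (Fin 2) F) := by
  obtain ⟨i, j, hij⟩ : ∃ i j : Fin m, i ≠ j := ⟨⟨0, by omega⟩, ⟨1, by omega⟩, by simp⟩
  let r : MulAction.orbitRel.Quotient (MulAut SL(2, F)) SL(2, F) →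
      MulAction.orbitRel.Quotient (MulAut (AffineSL m F)) (AffineSL m F) := fun q =>
    Quotient.liftOn' q (fun s => Quotient.mk'' (affElt 0 s)) fun s t h => by
      obtain ⟨α, hα⟩ := orbit_mk_eq_iff.1 (Quotient.eq''.2 h)
      rw [orbit_mk_eq_iff, ← hα]
      exact (autLifts α).autConj_zero s
  have hr : Function.Bijective (Sum.elim (fun k => Quotient.mk'' (extraRep F i j k)) r) := by
    constructor
    · refine Function.Injective.sumElim (fun k l h => extraRep_autConj hij (orbit_mk_eq_iff.1 h))
        (fun p q => ?_) (fun k q => ?_)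
      · induction p, q using Quotient.inductionOn₂' with | h s t =>
        exact fun h => orbit_mk_eq_iff.2 (orbit_mk_eq_iff.1 h).right
      · induction q using Quotient.inductionOn' with | h s =>
        exact fun h => not_autConj_extraRep_affElt k s (orbit_mk_eq_iff.1 h)
    · intro q
      induction q using Quotient.inductionOn' with | h g =>
      rcases exists_autConj_rep hij g with ⟨k, hk⟩ | ⟨s, hs⟩
      · exact ⟨Sum.inl k, orbit_mk_eq_iff.2 hk.symm⟩
      · exact ⟨Sum.inr (Quotient.mk'' s), orbit_mk_eq_iff.2 hs.symm⟩
  have e := Cardinal.mk_congr (Equiv.ofBijective _ hr)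
  rw [autOrbitCount, autOrbitCount, ← e, Cardinal.mk_sum]
  simp
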